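/- Let $d \ge 2$ be fixed. A $d$-dimensional polyomino with $n$ tiles is a union of $n$ distinct closed unit cubes of the regular cubical tessellation of $\mathbb{R}^d$ (the cubes $\prod_{i=1}^d [z_i, z_i+1]$ with $z \in \mathbb{Z}^d$) whose interior is connected and non-empty. A hole of a polyomino $P$ is a bounded connected component of $\mathbb{R}^d \setminus P$. For $n \ge 1$, every $d$-dimensional polyomino with $n$ tiles has finitely many holes, and among these polyominoes the number of holes attains a maximum, denoted $f_d(n)$. Then $$f_d(n) = \frac{d-1}{d}\,n - \Theta\bigl(n^{\frac{d-1}{d}}\bigr) \qquad (n \to \infty),$$ that is, there are constants $c, C > 0$ depending only on $d$ such that, for all sufficiently large $n$, $$\frac{d-1}{d}\,n - C\,n^{\frac{d-1}{d}} \;\le\; f_d(n) \;\le\; \frac{d-1}{d}\,n - c\,n^{\frac{d-1}{d}}.$$ Moreover, for all sufficiently large $n$ (depending on $d$), $$f_d(n) \le \frac{d-1}{d}\,n - n^{\frac{d-1}{d}}.$$ -/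

import Mathlib

open Filter

namespace Polyomino

/-- The closed unit cube of the regular cubical tessellation of `ℝ^d` whose lowest corner is `z`.
Only the topology and the bounded sets of `ℝ^d` are used below, and these are
the same for the sup norm on `Fin d → ℝ` and for the Euclidean norm. -/
def tile {d : ℕ} (z : Fin d → ℤ) : Set (Fin d → ℝ) :=
  Set.Icc (fun i => (z i : ℝ)) (fun i => (z i : ℝ) + 1)

/-- `P` is a `d`-dimensional polyomino with `n` tiles: a union of `n` distinct tiles whose
interior is connected (in particular non-empty). -/
def IsOmino (d n : ℕ) (P : Set (Fin d → ℝ)) : Prop :=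
  (∃ T : Finset (Fin d → ℤ), T.card = n ∧ P = ⋃ z ∈ T, tile z) ∧ IsConnected (interior P)

/-- The holes of `P`: the bounded connected components of the complement of `P`. -/
def holes {d : ℕ} (P : Set (Fin d → ℝ)) : Set (Set (Fin d → ℝ)) :=
  {U | (∃ x ∈ Pᶜ, U = connectedComponentIn Pᶜ x) ∧ Bornology.IsBounded U}

/-- The numbers of holes of the `d`-dimensional polyominoes with `n` tiles. -/
def holeCounts (d n : ℕ) : Set ℕ :=
  {h | ∃ P : Set (Fin d → ℝ), IsOmino d n P ∧ (holes P).ncard = h}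

/-- `f_d(n)`, the maximum number of holes in a `d`-dimensional polyomino with `n` tiles. -/
noncomputable def maxHoles (d n : ℕ) : ℕ :=
  sSup (holeCounts d n)

end Polyomino

/-! Topology reduces to cells: the interior and the complement of a union of tiles are both of the
form `region G`, and connectedness there is connectedness of cells through facets.

Upper bound. Let `T` be the `n` cells, let there be `h` holes, and let `W` be the set of their
cells. Count the `2dn` facets of cells of `T` by what lies across. At least `2(n-1)` face `T`, since
a connected graph contains a spanning tree; at least `2dh` face `W`, since every hole has an exit in
each signed direction; the rest bound `T ∪ W`, and number at least `2d(n+h)^((d-1)/d)` by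
isoperimetry (Loomis–Whitney and AM–GM). This is `family_bound`; the strict gain of `n+h` over `n`
absorbs the additive constant.

Lower bound. Inside a full box, empty the inner cells of one parity that avoid a code class `∑ i * v
i ≡ b` mod `2d-1`. Equal parity isolates the empty cells, so each is a hole. The code consists of
lines in direction `0`, which stay full and reach a full face, and every other cell has a neighbour
on such a line, so the full cells stay connected (`cellConnected_box_sdiff`). By averaging, a
proportion `(d-1)/(2d-1)` of the inner box can be emptied, which makes the ratio of holes to tiles
tend to `(d-1)/d`; the boundary of the box costs only `O(n^((d-1)/d))`. -/

namespace Polyomino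

/-! ### From topology to facet-connected sets of cells -/

section

variable {d : ℕ}

/-- The unit step in the coordinate direction `δ.1` with sign `δ.2`. -/
def dir (δ : Fin d × ℤˣ) : Fin d → ℤ := Pi.single δ.1 (δ.2 : ℤ)

/-- The centre of a tile. -/
noncomputable def center (z : Fin d → ℤ) : Fin d → ℝ := fun i => (z i : ℝ) + 1 / 2

/-- The set of points all of whose tiles belong to `G`. -/
def region (G : Set (Fin d → ℤ)) : Set (Fin d → ℝ) := {x | ∀ w, x ∈ tile w → w ∈ G}

/-- `A` is closed under taking facet-neighbours inside `G`. -/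
def AdjClosed (A G : Set (Fin d → ℤ)) : Prop := ∀ u ∈ A, ∀ δ, u + dir δ ∈ G → u + dir δ ∈ A

/-- `G` is non-empty and any two of its cells are joined by a chain of facet-neighbours. -/
def CellConnected (G : Set (Fin d → ℤ)) : Prop :=
  ∃ b ∈ G, ∀ A ⊆ G, b ∈ A → AdjClosed A G → G ⊆ A

theorem dir_neg (i : Fin d) (u : ℤˣ) : dir (i, -u) = -dir (i, u) := by
  simp [dir, Pi.single_neg]

theorem mem_tile {z : Fin d → ℤ} {x : Fin d → ℝ} :
    x ∈ tile z ↔ ∀ i, (z i : ℝ) ≤ x i ∧ x i ≤ z i + 1 := by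
  simp only [tile, Set.mem_Icc, Pi.le_def, ← forall_and]

theorem mem_tile_floor (x : Fin d → ℝ) : x ∈ tile (fun i => ⌊x i⌋) :=
  mem_tile.2 fun _ => ⟨Int.floor_le _, (Int.lt_floor_add_one _).le⟩

theorem eq_of_mem_tile {z w : Fin d → ℤ} {x : Fin d → ℝ}
    (hx : ∀ i, (z i : ℝ) < x i ∧ x i < z i + 1) (hw : x ∈ tile w) : w = z := by
  funext i
  have h1 := hx i
  have h2 := mem_tile.1 hw i
  have a : (w i : ℝ) < z i + 1 := by linarith
  have b : (z i : ℝ) < w i + 1 := by linarith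
  norm_cast at a b
  omega

theorem center_mem_tile_iff {z w : Fin d → ℤ} : center z ∈ tile w ↔ w = z := by
  refine ⟨fun h => eq_of_mem_tile (fun i => ?_) h, ?_⟩
  · simp only [center]; constructor <;> linarith
  · rintro rfl
    exact mem_tile.2 fun i => by simp only [center]; constructor <;> linarith

theorem center_mem_region {G : Set (Fin d → ℤ)} {z : Fin d → ℤ} : center z ∈ region G ↔ z ∈ G := by
  simp [region, center_mem_tile_iff]

theorem isOpen_region (G : Set (Fin d → ℤ)) : IsOpen (region G) := by
  rw [isOpen_iff_mem_nhds]
  intro x hx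
  -- For `y` this close to `x`, every tile containing `y` also contains `x`.
  have key : ∀ᶠ y in nhds x, ∀ i, y i ∈ Set.Ioo ((⌈x i⌉ : ℝ) - 1) (⌊x i⌋ + 1) := by
    rw [eventually_all]
    intro i
    refine (continuous_apply i).continuousAt.eventually (Ioo_mem_nhds ?_ (Int.lt_floor_add_one _))
    linarith [Int.ceil_lt_add_one (x i)]
  filter_upwards [key] with y hy w hw
  refine hx w (mem_tile.2 fun i => ?_)
  have h1 := hy i
  have h2 := mem_tile.1 hw i
  have a : (w i : ℝ) < ⌊x i⌋ + 1 := by linarith [h1.2]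
  have b : (⌈x i⌉ : ℝ) < w i + 2 := by linarith [h1.1]
  norm_cast at a b
  have a' : (w i : ℝ) ≤ ⌊x i⌋ := by exact_mod_cast (by omega : w i ≤ ⌊x i⌋)
  have b' : (⌈x i⌉ : ℝ) ≤ w i + 1 := by exact_mod_cast (by omega : ⌈x i⌉ ≤ w i + 1)
  exact ⟨a'.trans (Int.floor_le _), (Int.le_ceil _).trans b'⟩

theorem compl_eq_region (T : Finset (Fin d → ℤ)) :
    (⋃ z ∈ T, tile z)ᶜ = region ((T : Set (Fin d → ℤ))ᶜ) := by
  ext x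
  simp only [region, Set.mem_compl_iff, Set.mem_iUnion, Set.mem_ofPred_eq, Finset.mem_coe]
  push Not
  exact ⟨fun h w hw hT => h w hT hw, fun h w hT hw => h w hw hT⟩

theorem interior_eq_region (T : Finset (Fin d → ℤ)) :
    interior (⋃ z ∈ T, tile z) = region (T : Set (Fin d → ℤ)) := by
  apply Set.Subset.antisymm
  · intro x hx w hw
    have hcl : x ∈ closure (Set.univ.pi fun i => Set.Ioo (w i : ℝ) (w i + 1)) := by
      rw [closure_pi_set]
      intro i _
      show x i ∈ closure (Set.Ioo (w i : ℝ) (w i + 1))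
      rw [closure_Ioo (by simp)]
      exact mem_tile.1 hw i
    -- A neighbourhood of `x` meets the open cube of `w`, whose points lie in no other tile; hence
    -- `w ∈ T`.
    obtain ⟨y, hy, hyw⟩ := mem_closure_iff.1 hcl _ isOpen_interior hx
    have := interior_subset hy
    simp only [Set.mem_iUnion] at this
    obtain ⟨z, hz, hyz⟩ := this
    rwa [← eq_of_mem_tile (fun i => hyw i (Set.mem_univ i)) hyz]
  · refine interior_maximal (fun x hx => ?_) (isOpen_region _)
    simp only [Set.mem_iUnion]
    exact ⟨_, hx _ (mem_tile_floor x), mem_tile_floor x⟩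

theorem segment_center_subset {G : Set (Fin d → ℤ)} {x : Fin d → ℝ} {z : Fin d → ℤ}
    (hx : x ∈ region G) (hz : x ∈ tile z) : segment ℝ x (center z) ⊆ region G := by
  rintro y ⟨a, b, ha, hb, hab, rfl⟩ w hw
  rcases hb.eq_or_lt with rfl | hb
  · obtain rfl : a = 1 := by linarith
    simp only [one_smul, zero_smul, add_zero] at hw
    exact hx w hw
  · rw [eq_of_mem_tile (z := z) (fun i => ?_) hw]
    · exact hx z hz
    · have h := mem_tile.1 hz i
      simp only [Pi.add_apply, Pi.smul_apply, smul_eq_mul, center]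
      have h1 := mul_le_mul_of_nonneg_left h.1 ha
      have h2 := mul_le_mul_of_nonneg_left h.2 ha
      obtain rfl : a = 1 - b := by linarith
      constructor <;> nlinarith

theorem segment_centers_subset {G : Set (Fin d → ℤ)} {z : Fin d → ℤ} {δ : Fin d × ℤˣ}
    (hz : z ∈ G) (hz' : z + dir δ ∈ G) :
    segment ℝ (center z) (center (z + dir δ)) ⊆ region G := by
  rintro y ⟨a, b, ha, hb, hab, rfl⟩ w hw
  obtain ⟨i, u⟩ := δ
  obtain rfl : a = 1 - b := by linarith
  have hj : ∀ j ≠ i, w j = z j := by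
    intro j hj
    have h := mem_tile.1 hw j
    simp only [Pi.add_apply, Pi.smul_apply, smul_eq_mul, center, dir, Pi.single_eq_of_ne hj,
      add_zero] at h
    have h1 : (w j : ℝ) < z j + 1 := by linarith
    have h2 : (z j : ℝ) < w j + 1 := by linarith
    norm_cast at h1 h2
    omega
  have hi : w i = z i ∨ w i = z i + u := by
    have h := mem_tile.1 hw i
    simp only [Pi.add_apply, Pi.smul_apply, smul_eq_mul, center, dir, Pi.single_eq_same] at h
    rcases Int.units_eq_one_or u with rfl | rfl
    · push_cast at h
      have h1 : (w i : ℝ) < z i + 2 := by linarith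
      have h2 : (z i : ℝ) < w i + 1 := by linarith
      norm_cast at h1 h2
      push_cast
      omega
    · push_cast at h
      have h1 : (w i : ℝ) < z i + 1 := by linarith
      have h2 : (z i : ℝ) < w i + 2 := by linarith
      norm_cast at h1 h2
      push_cast
      omega
  rcases hi with hi | hi
  · convert hz
    funext j
    by_cases h : j = i
    · rw [h, hi]
    · exact hj j h
  · convert hz'
    funext j
    by_cases h : j = i
    · rw [h, hi]; simp [dir]
    · simp [dir, Pi.single_eq_of_ne h, hj j h]

/-- Two tiles through `x` differ by at most 1 in each coordinate. Changing the coordinates one at a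
time is a chain of facet steps through tiles that still contain `x`, hence lie in `G`. So contacts
in lower-dimensional faces create no connections beyond those through facets. -/
theorem AdjClosed.mem_of_mem_tile {A G : Set (Fin d → ℤ)} (hA : AdjClosed A G) {x : Fin d → ℝ}
    (hx : x ∈ region G) {w w' : Fin d → ℤ} (hw : w ∈ A) (hxw : x ∈ tile w) (hxw' : x ∈ tile w') :
    w' ∈ A := by
  classical
  have key : ∀ s : Finset (Fin d), s.piecewise w' w ∈ A := by
    intro s
    induction s using Finset.induction_on with
    | empty => simpa using hw
    | insert i s his ih =>
      have hG : (insert i s).piecewise w' w ∈ G := by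
        refine hx _ (mem_tile.2 fun j => ?_)
        by_cases hj : j ∈ insert i s
        · simpa [Finset.piecewise_eq_of_mem _ _ _ hj] using mem_tile.1 hxw' j
        · simpa [Finset.piecewise_eq_of_notMem _ _ _ hj] using mem_tile.1 hxw j
      rw [Finset.piecewise_insert] at hG ⊢
      have h1 := mem_tile.1 hxw i
      have h2 := mem_tile.1 hxw' i
      have a : (w i : ℝ) ≤ w' i + 1 := by linarith
      have b : (w' i : ℝ) ≤ w i + 1 := by linarith
      norm_cast at a b
      have hval : s.piecewise w' w i = w i := Finset.piecewise_eq_of_notMem _ _ _ his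
      have step : ∀ u : ℤˣ, w' i = w i + u →
          Function.update (s.piecewise w' w) i (w' i) = s.piecewise w' w + dir (i, u) := by
        intro u hu
        funext j
        by_cases hj : j = i
        · subst hj; simp [dir, hval, hu]
        · simp [dir, Function.update_of_ne hj, Pi.single_eq_of_ne hj]
      rcases (by omega : w' i = w i ∨ w' i = w i + 1 ∨ w' i = w i - 1) with h | h | h
      · rw [h, ← hval, Function.update_eq_self]; exact ih
      · rw [step 1 (by simpa using h)] at hG ⊢
        exact hA _ ih _ hG
      · rw [step (-1) (by simp [h, sub_eq_add_neg])] at hG ⊢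
        exact hA _ ih _ hG
  simpa using key Finset.univ

theorem AdjClosed.diff {A G : Set (Fin d → ℤ)} (hA : AdjClosed A G) : AdjClosed (G \ A) G := by
  rintro u ⟨huG, huA⟩ ⟨i, v⟩ h
  refine ⟨h, fun hmem => huA ?_⟩
  have := hA _ hmem (i, -v)
  rw [dir_neg, add_neg_cancel_right] at this
  exact this huG

/-- A preconnected part of `region G` cannot leave an adjacency-closed family of cells. -/
theorem AdjClosed.subset_region {A G : Set (Fin d → ℤ)} (hA : AdjClosed A G)
    {K : Set (Fin d → ℝ)} (hK : IsPreconnected K) (hKG : K ⊆ region G) {x : Fin d → ℝ}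
    (hx : x ∈ K) {z : Fin d → ℤ} (hxz : x ∈ tile z) (hz : z ∈ A) : K ⊆ region A := by
  have hin : ∀ {B : Set (Fin d → ℤ)}, AdjClosed B G → ∀ y ∈ K, ∀ w ∈ B, y ∈ tile w →
      y ∈ region B := fun hB y hy w hw hyw w' hw' => hB.mem_of_mem_tile (hKG hy) hw hyw hw'
  refine IsPreconnected.subset_left_of_subset_union (isOpen_region A) (isOpen_region (G \ A)) ?_ ?_
    ⟨x, hx, hin hA x hx z hz hxz⟩ hK
  · rw [Set.disjoint_left]
    exact fun y h1 h2 => (h2 _ (mem_tile_floor y)).2 (h1 _ (mem_tile_floor y))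
  · intro y hy
    by_cases h : (fun i => ⌊y i⌋) ∈ A
    · exact Or.inl (hin hA y hy _ h (mem_tile_floor y))
    · exact Or.inr (hin hA.diff y hy _ ⟨hKG hy _ (mem_tile_floor y), h⟩ (mem_tile_floor y))

theorem cellConnected_of_isConnected {G : Set (Fin d → ℤ)} (h : IsConnected (region G)) :
    CellConnected G := by
  obtain ⟨⟨x, hx⟩, hc⟩ := h
  refine ⟨_, hx _ (mem_tile_floor x), fun A _ hbA hA z hz => ?_⟩
  exact center_mem_region.1
    (hA.subset_region hc subset_rfl hx (mem_tile_floor x) hbA (center_mem_region.2 hz))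

theorem adjClosed_center_mem_component (G : Set (Fin d → ℤ)) (x : Fin d → ℝ) :
    AdjClosed {z ∈ G | center z ∈ connectedComponentIn (region G) x} G := by
  rintro u ⟨hu, hux⟩ δ hG
  refine ⟨hG, ?_⟩
  rw [connectedComponentIn_eq hux]
  exact (convex_segment _ _).isPreconnected.subset_connectedComponentIn (left_mem_segment ℝ _ _)
    (segment_centers_subset hu hG) (right_mem_segment ℝ _ _)

theorem center_mem_component {G : Set (Fin d → ℤ)} {x y : Fin d → ℝ}
    (hy : y ∈ connectedComponentIn (region G) x) {z : Fin d → ℤ} (hyz : y ∈ tile z) :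
    center z ∈ connectedComponentIn (region G) x := by
  have hyG := connectedComponentIn_subset _ _ hy
  rw [connectedComponentIn_eq hy]
  exact (convex_segment _ _).isPreconnected.subset_connectedComponentIn (left_mem_segment ℝ _ _)
    (segment_center_subset hyG hyz) (right_mem_segment ℝ _ _)

theorem CellConnected.isConnected {G : Set (Fin d → ℤ)} (h : CellConnected G) :
    IsConnected (region G) := by
  obtain ⟨b, hb, hG⟩ := h
  have hbr : center b ∈ region G := center_mem_region.2 hb
  have hsub : G ⊆ {z ∈ G | center z ∈ connectedComponentIn (region G) (center b)} :=
    hG _ (Set.sep_subset _ _) ⟨hb, mem_connectedComponentIn hbr⟩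
      (adjClosed_center_mem_component G _)
  have : region G = connectedComponentIn (region G) (center b) := by
    refine Set.Subset.antisymm (fun x hx => ?_) (connectedComponentIn_subset _ _)
    have h1 := (hsub (hx _ (mem_tile_floor x))).2
    rw [connectedComponentIn_eq h1]
    exact (convex_segment _ _).isPreconnected.subset_connectedComponentIn
      (right_mem_segment ℝ _ _) (segment_center_subset hx (mem_tile_floor x))
      (left_mem_segment ℝ _ _)
  rw [this]
  exact isConnected_connectedComponentIn_iff.2 hbr

theorem isOmino_iff {n : ℕ} {P : Set (Fin d → ℝ)} :
    IsOmino d n P ↔ ∃ T : Finset (Fin d → ℤ), T.card = n ∧ P = ⋃ z ∈ T, tile z ∧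
      CellConnected (T : Set (Fin d → ℤ)) := by
  constructor
  · rintro ⟨⟨T, hT, rfl⟩, hc⟩
    rw [interior_eq_region] at hc
    exact ⟨T, hT, rfl, cellConnected_of_isConnected hc⟩
  · rintro ⟨T, hT, rfl, hc⟩
    refine ⟨⟨T, hT, rfl⟩, ?_⟩
    rw [interior_eq_region]
    exact hc.isConnected

/-! ### Loomis–Whitney and the isoperimetric inequality -/

/-- Hölder's inequality for `m` factors with equal exponents. -/
theorem sum_prod_rpow_le {ι κ : Type*} (s : Finset ι) (t : Finset κ) (ht : t.Nonempty)
    (a : κ → ι → ℝ) (ha : ∀ j i, 0 ≤ a j i) :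
    ∑ i ∈ s, ∏ j ∈ t, a j i ^ (1 / (t.card : ℝ)) ≤
      ∏ j ∈ t, (∑ i ∈ s, a j i) ^ (1 / (t.card : ℝ)) := by
  have hm : (0 : ℝ) < t.card := by exact_mod_cast ht.card_pos
  have hS : ∀ j, 0 ≤ ∑ i ∈ s, a j i := fun j => Finset.sum_nonneg fun i _ => ha j i
  by_cases h0 : ∃ j ∈ t, ∑ i ∈ s, a j i = 0
  · obtain ⟨j, hj, h0⟩ := h0
    have hz := (Finset.sum_eq_zero_iff_of_nonneg fun i _ => ha j i).1 h0
    rw [Finset.sum_eq_zero]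
    · exact Finset.prod_nonneg fun j _ => Real.rpow_nonneg (hS j) _
    · intro i hi
      refine Finset.prod_eq_zero hj ?_
      rw [hz i hi, Real.zero_rpow (by positivity)]
  · push Not at h0
    have hpos : ∀ j ∈ t, 0 < ∑ i ∈ s, a j i := fun j hj => (hS j).lt_of_ne' (h0 j hj)
    have hP : 0 < ∏ j ∈ t, (∑ i ∈ s, a j i) ^ (1 / (t.card : ℝ)) :=
      Finset.prod_pos fun j hj => Real.rpow_pos_of_pos (hpos j hj) _
    -- After normalising every `a j` to total mass 1, AM–GM applies termwise.
    rw [← div_le_one hP, Finset.sum_div]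
    calc ∑ i ∈ s, (∏ j ∈ t, a j i ^ (1 / (t.card : ℝ))) /
          ∏ j ∈ t, (∑ i ∈ s, a j i) ^ (1 / (t.card : ℝ))
        ≤ ∑ i ∈ s, ∑ j ∈ t, (1 / (t.card : ℝ)) * (a j i / ∑ i ∈ s, a j i) := by
          refine Finset.sum_le_sum fun i _ => ?_
          rw [← Finset.prod_div_distrib]
          have := Real.geom_mean_le_arith_mean_weighted t (fun _ => 1 / (t.card : ℝ))
            (fun j => a j i / ∑ i ∈ s, a j i) (fun _ _ => by positivity)
            (by simp [hm.ne']) (fun j _ => div_nonneg (ha j i) (hS j))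
          refine le_trans (le_of_eq (Finset.prod_congr rfl fun j _ => ?_)) this
          rw [Real.div_rpow (ha j i) (hS j)]
      _ = ∑ j ∈ t, (1 / (t.card : ℝ)) := by
          rw [Finset.sum_comm]
          refine Finset.sum_congr rfl fun j hj => ?_
          rw [← Finset.mul_sum, ← Finset.sum_div, div_self (hpos j hj).ne', mul_one]
      _ ≤ 1 := by simp [hm.ne']

/-- The projection of a set of cells along the `i`-th coordinate. -/
def proj (i : Fin d) (S : Finset (Fin d → ℤ)) : Finset (Fin d → ℤ) :=
  S.image fun v => Function.update v i 0

/-- The slice of `S` at height `t` of the first coordinate. -/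
def slice (S : Finset (Fin (d + 1) → ℤ)) (t : ℤ) : Finset (Fin d → ℤ) :=
  (S.filter fun v => v 0 = t).image Fin.tail

theorem mem_slice {S : Finset (Fin (d + 1) → ℤ)} {t : ℤ} {w : Fin d → ℤ} :
    w ∈ slice S t ↔ (Fin.cons t w : Fin (d + 1) → ℤ) ∈ S := by
  simp only [slice, Finset.mem_image, Finset.mem_filter]
  constructor
  · rintro ⟨v, ⟨hv, rfl⟩, rfl⟩
    rwa [Fin.cons_self_tail]
  · exact fun h => ⟨_, ⟨h, by simp⟩, by simp⟩

theorem card_eq_sum_card_slice (S : Finset (Fin (d + 1) → ℤ)) (I : Finset ℤ)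
    (hI : ∀ v ∈ S, v 0 ∈ I) : S.card = ∑ t ∈ I, (slice S t).card := by
  rw [Finset.card_eq_sum_card_fiberwise hI]
  refine Finset.sum_congr rfl fun t _ => ?_
  rw [slice, Finset.card_image_of_injOn]
  intro v hv w hw h
  simp only [Finset.coe_filter, Set.mem_ofPred_eq] at hv hw
  rw [← Fin.cons_self_tail v, ← Fin.cons_self_tail w, h, hv.2, hw.2]

theorem slice_proj_succ (S : Finset (Fin (d + 1) → ℤ)) (t : ℤ) (j : Fin d) :
    slice (proj j.succ S) t = proj j (slice S t) := by
  ext w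
  simp only [mem_slice, proj, Finset.mem_image]
  constructor
  · rintro ⟨v, hv, h⟩
    rw [← Fin.cons_self_tail v, ← Fin.cons_update, Fin.cons_inj] at h
    refine ⟨Fin.tail v, ?_, h.2⟩
    rwa [← h.1, Fin.cons_self_tail]
  · rintro ⟨v, hv, rfl⟩
    exact ⟨_, hv, by rw [← Fin.cons_update]⟩

theorem card_slice_le (S : Finset (Fin (d + 1) → ℤ)) (t : ℤ) :
    (slice S t).card ≤ (proj 0 S).card := by
  refine Finset.card_le_card_of_injOn (fun w => (Fin.cons 0 w : Fin (d + 1) → ℤ)) ?_ ?_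
  · intro w hw
    simp only [proj, Finset.coe_image, Set.mem_image, Finset.mem_coe]
    exact ⟨_, mem_slice.1 hw, by rw [Fin.update_cons_zero]⟩
  · intro w _ w' _ h
    exact (Fin.cons_inj.1 h).2

/-- Slice along coordinate `0`. A slice is at most as large as the projection along `0`, and the
inductive hypothesis bounds its power `d` by its own projections. The product of the two bounds,
after a root of order `d + 1`, is summed over the slices by Hölder. -/
theorem card_pow_le_prod_card_proj_succ
    (ih : ∀ S : Finset (Fin (d + 1) → ℤ), S.Nonempty →
      (S.card : ℝ) ^ d ≤ ∏ i, ((proj i S).card : ℝ))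
    (S : Finset (Fin (d + 2) → ℤ)) :
    (S.card : ℝ) ^ (d + 1) ≤ ∏ i, ((proj i S).card : ℝ) := by
  set I := S.image fun v => v 0 with hI
  have hSI : ∀ v ∈ S, v 0 ∈ I := fun v hv => Finset.mem_image_of_mem _ hv
  obtain ⟨m, hm⟩ : ∃ m : ℝ, m = ((proj 0 S).card : ℝ) := ⟨_, rfl⟩
  have hm0 : 0 ≤ m := hm ▸ Nat.cast_nonneg _
  obtain ⟨p, hp⟩ : ∃ p : ℝ, p = 1 / ((d + 1 : ℕ) : ℝ) := ⟨_, rfl⟩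
  have hpn : 0 ≤ p := hp ▸ by positivity
  have hp0 : ((d + 1 : ℕ) : ℝ) ≠ 0 := by positivity
  obtain ⟨a, ha⟩ : ∃ a : Fin (d + 1) → ℤ → ℝ, ∀ j t, a j t = ((proj j (slice S t)).card : ℝ) :=
    ⟨_, fun _ _ => rfl⟩
  have ha0 : ∀ j t, 0 ≤ a j t := fun j t => ha j t ▸ Nat.cast_nonneg _
  have hsum : ∀ j, ∑ t ∈ I, a j t = ((proj j.succ S).card : ℝ) := by
    intro j
    rw [card_eq_sum_card_slice (proj j.succ S) I]
    · rw [Nat.cast_sum]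
      exact Finset.sum_congr rfl fun t _ => by rw [slice_proj_succ, ha]
    · intro v hv
      obtain ⟨w, hw, rfl⟩ := Finset.mem_image.1 hv
      rw [Function.update_of_ne (Fin.succ_ne_zero j).symm]
      exact hSI w hw
  have hslice : ∀ t, ((slice S t).card : ℝ) ≤ m ^ p * ∏ j, a j t ^ p := by
    intro t
    rcases (slice S t).eq_empty_or_nonempty with h | h
    · rw [h]; simp only [Finset.card_empty, Nat.cast_zero]
      exact mul_nonneg (Real.rpow_nonneg hm0 _)
        (Finset.prod_nonneg fun j _ => Real.rpow_nonneg (ha0 j t) _)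
    · have h1 := ih (slice S t) h
      simp only [← ha] at h1
      have h2 : ((slice S t).card : ℝ) ^ (d + 1) ≤ m * ∏ j, a j t := by
        rw [pow_succ']
        exact mul_le_mul (hm ▸ Nat.cast_le.2 (card_slice_le S t)) h1
          (pow_nonneg (Nat.cast_nonneg _) _) hm0
      rw [Real.finsetProd_rpow _ _ (fun j _ => ha0 j t), ← Real.mul_rpow hm0
        (Finset.prod_nonneg fun j _ => ha0 j t)]
      calc ((slice S t).card : ℝ) = (((slice S t).card : ℝ) ^ (d + 1)) ^ p := by
            rw [← Real.rpow_natCast, ← Real.rpow_mul (by positivity), hp, mul_one_div_cancel hp0,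
              Real.rpow_one]
        _ ≤ _ := Real.rpow_le_rpow (pow_nonneg (Nat.cast_nonneg _) _) h2 hpn
  have hmain : (S.card : ℝ) ≤ (m * ∏ j : Fin (d + 1), ((proj j.succ S).card : ℝ)) ^ p := by
    rw [card_eq_sum_card_slice S I hSI]
    rw [Nat.cast_sum]
    calc ∑ t ∈ I, ((slice S t).card : ℝ) ≤ ∑ t ∈ I, m ^ p * ∏ j, a j t ^ p :=
          Finset.sum_le_sum fun t _ => hslice t
      _ = m ^ p * ∑ t ∈ I, ∏ j, a j t ^ p := by rw [Finset.mul_sum]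
      _ ≤ m ^ p * ∏ j, (∑ t ∈ I, a j t) ^ p := by
          have := sum_prod_rpow_le I (Finset.univ : Finset (Fin (d + 1)))
            Finset.univ_nonempty a ha0
          rw [Finset.card_univ, Fintype.card_fin, ← hp] at this
          exact mul_le_mul_of_nonneg_left this (Real.rpow_nonneg hm0 _)
      _ = _ := by
          simp only [hsum]
          rw [Real.finsetProd_rpow _ _ (fun j _ => Nat.cast_nonneg _), ← Real.mul_rpow hm0
            (Finset.prod_nonneg fun j _ => Nat.cast_nonneg _)]
  rw [Fin.prod_univ_succ, ← hm]
  calc (S.card : ℝ) ^ (d + 1) ≤ _ := pow_le_pow_left₀ (by positivity) hmain _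
    _ = _ := by
      have h0 : (0 : ℝ) ≤ m * ∏ j : Fin (d + 1), ((proj j.succ S).card : ℝ) :=
        mul_nonneg hm0 (Finset.prod_nonneg fun j _ => Nat.cast_nonneg _)
      rw [← Real.rpow_natCast, ← Real.rpow_mul h0, hp,
        one_div_mul_cancel hp0, Real.rpow_one]

/-- The Loomis–Whitney inequality. -/
theorem card_pow_le_prod_card_proj :
    ∀ {d : ℕ} (S : Finset (Fin d → ℤ)), S.Nonempty →
      (S.card : ℝ) ^ (d - 1) ≤ ∏ i, ((proj i S).card : ℝ)
  | 0, S, _ => by simp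
  | 1, S, hS => by
    have : 0 < (proj 0 S).card := (hS.image _).card_pos
    simpa using Nat.one_le_iff_ne_zero.2 this.ne'
  | _ + 2, S, _ =>
    card_pow_le_prod_card_proj_succ (fun S hS => card_pow_le_prod_card_proj S hS) S

/-- The cells of `V` whose neighbour in direction `δ` lies outside `V`. -/
def exits (V : Finset (Fin d → ℤ)) (δ : Fin d × ℤˣ) : Finset (Fin d → ℤ) :=
  V.filter fun v => v + dir δ ∉ V

theorem exists_exit (V : Finset (Fin d → ℤ)) (δ : Fin d × ℤˣ) {v : Fin d → ℤ} (hv : v ∈ V) :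
    ∃ k : ℕ, v + k • dir δ ∈ exits V δ := by
  by_contra! h
  have hall : ∀ k : ℕ, v + k • dir δ ∈ V := by
    intro k
    induction k with
    | zero => simpa using hv
    | succ k ih =>
      by_contra hn
      refine h k (Finset.mem_filter.2 ⟨ih, ?_⟩)
      rwa [add_assoc, ← succ_nsmul]
  refine Set.infinite_of_injective_forall_mem (f := fun k : ℕ => v + k • dir δ) ?_ hall
    V.finite_toSet
  intro k l hkl
  have h1 := congrFun (add_left_cancel hkl) δ.1
  simpa [dir] using h1

/-- Every line in direction `δ` that meets the finite set `V` must leave it, and moving along the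
line does not change the projection. -/
theorem card_proj_le_card_exits (V : Finset (Fin d → ℤ)) (δ : Fin d × ℤˣ) :
    (proj δ.1 V).card ≤ (exits V δ).card := by
  refine (Finset.card_le_card ?_).trans
    (Finset.card_image_le (s := exits V δ) (f := fun v => Function.update v δ.1 0))
  intro w hw
  obtain ⟨v, hv, rfl⟩ := Finset.mem_image.1 hw
  obtain ⟨k, hk⟩ := exists_exit V δ hv
  refine Finset.mem_image.2 ⟨_, hk, ?_⟩
  funext j
  by_cases hj : j = δ.1
  · subst hj; simp
  · simp [Function.update_of_ne hj, dir, Pi.single_eq_of_ne hj]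

theorem two_mul_le_sum_card_exits {V : Finset (Fin d → ℤ)} (hV : V.Nonempty) :
    2 * d ≤ ∑ δ, (exits V δ).card := by
  calc 2 * d = ∑ _δ : Fin d × ℤˣ, 1 := by simp [mul_comm]
    _ ≤ _ := Finset.sum_le_sum fun δ _ => by
      obtain ⟨v, hv⟩ := hV
      obtain ⟨k, hk⟩ := exists_exit V δ hv
      exact Finset.card_pos.2 ⟨_, hk⟩

/-- The isoperimetric inequality for sets of cells. -/
theorem isoperimetric (hd : 1 ≤ d) {V : Finset (Fin d → ℤ)} (hV : V.Nonempty) :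
    2 * d * (V.card : ℝ) ^ (((d : ℝ) - 1) / d) ≤ ∑ δ, ((exits V δ).card : ℝ) := by
  have hd0 : (0 : ℝ) < d := by exact_mod_cast hd
  have h1 := Real.geom_mean_le_arith_mean_weighted (Finset.univ : Finset (Fin d))
    (fun _ => 1 / (d : ℝ)) (fun i => ((proj i V).card : ℝ)) (fun _ _ => by positivity)
    (by simp [hd0.ne']) (fun j _ => by positivity)
  rw [Real.finsetProd_rpow _ _ (fun j _ => by positivity), ← Finset.mul_sum] at h1
  have h2 : (V.card : ℝ) ^ (((d : ℝ) - 1) / d) ≤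
      (∏ i, ((proj i V).card : ℝ)) ^ (1 / (d : ℝ)) := by
    have := Real.rpow_le_rpow (by positivity) (card_pow_le_prod_card_proj V hV)
      (by positivity : 0 ≤ 1 / (d : ℝ))
    rwa [← Real.rpow_natCast, ← Real.rpow_mul (by positivity), Nat.cast_sub hd, Nat.cast_one,
      mul_one_div] at this
  have h3 : ∑ δ : Fin d × ℤˣ, ((proj δ.1 V).card : ℝ) = 2 * ∑ i, ((proj i V).card : ℝ) := by
    rw [Fintype.sum_prod_type, Finset.mul_sum]
    simp
  calc 2 * d * (V.card : ℝ) ^ (((d : ℝ) - 1) / d)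
      ≤ 2 * d * (1 / d * ∑ i, ((proj i V).card : ℝ)) :=
        mul_le_mul_of_nonneg_left (h2.trans h1) (by positivity)
    _ = 2 * ∑ i, ((proj i V).card : ℝ) := by field_simp
    _ = ∑ δ : Fin d × ℤˣ, ((proj δ.1 V).card : ℝ) := h3.symm
    _ ≤ _ := Finset.sum_le_sum fun δ _ => by exact_mod_cast card_proj_le_card_exits V δ

/-! ### The facet count behind the upper bound -/

/-- A connected set of `n` cells has at least `n - 1` pairs of facet-neighbours. -/
theorem two_mul_card_le (T : Finset (Fin d → ℤ)) (hc : CellConnected (T : Set (Fin d → ℤ))) :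
    2 * T.card ≤ ∑ δ, (T.filter fun v => v + dir δ ∈ T).card + 2 := by
  classical
  obtain ⟨b, hb, hT⟩ := hc
  let G : SimpleGraph T :=
    { Adj := fun u v => ∃ δ, (v : Fin d → ℤ) = (u : Fin d → ℤ) + dir δ
      symm := ⟨by
        rintro u v ⟨⟨i, s⟩, h⟩
        exact ⟨(i, -s), by rw [dir_neg, h, add_neg_cancel_right]⟩⟩
      loopless := ⟨by
        rintro u ⟨δ, h⟩
        have h1 := congrFun h δ.1
        simp [dir] at h1⟩ }
  have hconn : G.Connected := by
    refine (SimpleGraph.connected_iff_exists_forall_reachable G).2 ⟨⟨b, hb⟩, fun w => ?_⟩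
    obtain ⟨h, hr⟩ := hT {v | ∃ h : v ∈ T, G.Reachable ⟨b, hb⟩ ⟨v, h⟩} (fun v hv => hv.1)
      ⟨hb, SimpleGraph.Reachable.refl _⟩ (by
        rintro u ⟨hu, hr⟩ δ hG
        exact ⟨hG, hr.trans (SimpleGraph.Adj.reachable ⟨δ, rfl⟩)⟩) w.2
    exact hr
  have h1 := hconn.card_vert_le_card_edgeSet_add_one
  have h2 := G.dart_card_eq_twice_card_edges
  rw [Nat.card_eq_fintype_card, Nat.card_eq_fintype_card, ← SimpleGraph.edgeFinset_card,
    Fintype.card_coe] at h1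
  have h3 : Fintype.card G.Dart ≤ ∑ δ, (T.filter fun v => v + dir δ ∈ T).card := by
    -- A dart is determined by its tail and its direction.
    rw [← Finset.card_sigma, ← Finset.card_univ]
    choose f hf using fun e : G.Dart => e.adj
    refine Finset.card_le_card_of_injOn (fun e => ⟨f e, (e.fst : Fin d → ℤ)⟩) ?_ ?_
    · intro e _
      simp only [Finset.mem_coe, Finset.mem_sigma, Finset.mem_univ, Finset.mem_filter, true_and]
      exact ⟨e.fst.2, by rw [← hf e]; exact e.snd.2⟩
    · intro e _ e' _ h
      simp only [Sigma.mk.injEq, heq_eq_eq] at h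
      have h4 : e.fst = e'.fst := Subtype.ext h.2
      have h5 : e.snd = e'.snd := Subtype.ext (by rw [hf e, hf e', h.1, h.2])
      exact SimpleGraph.Dart.ext _ _ (Prod.ext h4 h5)
  omega

/-- Double counting the facets of the cells of `T`. -/
theorem family_bound (hd : 1 ≤ d) {T : Finset (Fin d → ℤ)}
    (hc : CellConnected (T : Set (Fin d → ℤ))) {ι : Type*} (F : Finset ι)
    (C : ι → Finset (Fin d → ℤ)) (hne : ∀ i ∈ F, (C i).Nonempty)
    (hdisj : Set.PairwiseDisjoint (F : Set ι) C) (hCT : ∀ i ∈ F, Disjoint T (C i))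
    (hcl : ∀ i ∈ F, ∀ v ∈ C i, ∀ δ, v + dir δ ∉ T → v + dir δ ∈ C i) :
    2 * d * (F.card : ℝ) + 2 * d * ((T.card : ℝ) + F.card) ^ (((d : ℝ) - 1) / d) ≤
      2 * (d - 1) * (T.card : ℝ) + 2 := by
  classical
  set W := F.biUnion C with hW
  have hTW : Disjoint T W := (Finset.disjoint_biUnion_right _ _ _).2 hCT
  have hWcl : ∀ v ∈ W, ∀ δ, v + dir δ ∉ T → v + dir δ ∈ W := by
    intro v hv δ h
    obtain ⟨i, hi, hvi⟩ := Finset.mem_biUnion.1 hv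
    exact Finset.mem_biUnion.2 ⟨i, hi, hcl i hi v hvi δ h⟩
  have hFW : F.card ≤ W.card := by
    rw [hW, Finset.card_biUnion hdisj, Finset.card_eq_sum_ones]
    exact Finset.sum_le_sum fun i hi => (hne i hi).card_pos
  have hexW : 2 * d * F.card ≤ ∑ δ, (exits W δ).card := by
    calc 2 * d * F.card = ∑ i ∈ F, 2 * d := by simp [mul_comm]
      _ ≤ ∑ i ∈ F, ∑ δ, (exits (C i) δ).card :=
        Finset.sum_le_sum fun i hi => two_mul_le_sum_card_exits (hne i hi)
      _ = ∑ δ, ∑ i ∈ F, (exits (C i) δ).card := Finset.sum_comm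
      _ ≤ _ := Finset.sum_le_sum fun δ _ => by
        unfold exits
        rw [← Finset.card_biUnion (fun i hi j hj hij =>
          (hdisj hi hj hij).mono (Finset.filter_subset _ _) (Finset.filter_subset _ _))]
        refine Finset.card_le_card fun v hv => ?_
        obtain ⟨i, hi, hvi⟩ := Finset.mem_biUnion.1 hv
        obtain ⟨hvC, hvn⟩ := Finset.mem_filter.1 hvi
        refine Finset.mem_filter.2 ⟨Finset.mem_biUnion.2 ⟨i, hi, hvC⟩, fun hmem => ?_⟩
        refine hvn (hcl i hi v hvC δ fun hT => ?_)
        exact Finset.disjoint_left.1 hTW hT hmem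
  -- A facet leaving `W` enters `T`; seen from `T` its direction is reversed.
  have hexW' : ∑ δ, (exits W δ).card ≤ ∑ δ, (T.filter fun v => v + dir δ ∈ W).card := by
    rw [← Equiv.sum_comp ((Equiv.refl (Fin d)).prodCongr (Equiv.neg ℤˣ))
      fun δ => (T.filter fun v => v + dir δ ∈ W).card]
    refine Finset.sum_le_sum fun δ _ => ?_
    refine Finset.card_le_card_of_injOn (fun v => v + dir δ) ?_
      (fun v _ w _ h => add_right_cancel h)
    intro v hv
    obtain ⟨hvW, hvn⟩ := Finset.mem_filter.1 hv
    have hneg : dir (((Equiv.refl (Fin d)).prodCongr (Equiv.neg ℤˣ)) δ) = -dir δ :=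
      dir_neg δ.1 δ.2
    refine Finset.mem_filter.2 ⟨?_, ?_⟩
    · by_contra h
      exact hvn (hWcl v hvW δ h)
    · simpa only [hneg, add_neg_cancel_right] using hvW
  have hTne : T.Nonempty := by
    obtain ⟨b, hb, -⟩ := hc
    exact ⟨b, hb⟩
  have hiso := isoperimetric hd (V := T ∪ W) (hTne.mono Finset.subset_union_left)
  -- The neighbour of a cell of `T` lies in `T`, in `W`, or outside both. Exits of `T ∪ W` start in
  -- `T`, because leaving `W` leads into `T`.
  have hsplit : ∀ δ, (T.filter fun v => v + dir δ ∈ T).card +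
      (T.filter fun v => v + dir δ ∈ W).card + (exits (T ∪ W) δ).card ≤ T.card := by
    intro δ
    rw [← Finset.card_union_of_disjoint, ← Finset.card_union_of_disjoint]
    · refine Finset.card_le_card fun v hv => ?_
      simp only [Finset.mem_union, Finset.mem_filter, exits] at hv
      rcases hv with (hv | hv) | ⟨hv | hv, hn⟩
      · exact hv.1
      · exact hv.1
      · exact hv
      · exact absurd (Or.inr (hWcl v hv δ fun h => hn (Or.inl h))) hn
    · rw [Finset.disjoint_left]
      intro v hv hv'
      have hn := (Finset.mem_filter.1 hv').2
      simp only [Finset.mem_union, Finset.mem_filter] at hv hn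
      rcases hv with hv | hv
      · exact hn (Or.inl hv.2)
      · exact hn (Or.inr hv.2)
    · rw [Finset.disjoint_left]
      intro v hv hv'
      exact Finset.disjoint_left.1 hTW (Finset.mem_filter.1 hv).2 (Finset.mem_filter.1 hv').2
  have hsum := Finset.sum_le_sum fun δ (_ : δ ∈ Finset.univ) => hsplit δ
  rw [Finset.sum_add_distrib, Finset.sum_add_distrib, Finset.sum_const, Finset.card_univ,
    Fintype.card_prod, Fintype.card_fin, Fintype.card_units_int, smul_eq_mul] at hsum
  have hedge := two_mul_card_le T hc
  have hcard : (T.card : ℝ) + F.card ≤ (T ∪ W).card := by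
    rw [Finset.card_union_of_disjoint hTW]
    exact_mod_cast Nat.add_le_add_left hFW _
  have hpow : ((T.card : ℝ) + F.card) ^ (((d : ℝ) - 1) / d) ≤
      ((T ∪ W).card : ℝ) ^ (((d : ℝ) - 1) / d) := by
    have : (1 : ℝ) ≤ d := by exact_mod_cast hd
    exact Real.rpow_le_rpow (by positivity) hcard (div_nonneg (by linarith) (by linarith))
  have hpow' := mul_le_mul_of_nonneg_left hpow (by positivity : (0 : ℝ) ≤ 2 * d)
  have key : 2 * T.card + 2 * d * F.card + ∑ δ, (exits (T ∪ W) δ).card ≤ d * 2 * T.card + 2 := by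
    omega
  have key' : 2 * (T.card : ℝ) + 2 * d * F.card + ∑ δ, ((exits (T ∪ W) δ).card : ℝ) ≤
      d * 2 * T.card + 2 := by exact_mod_cast key
  linarith

/-! ### Applying the count to holes -/

theorem finite_center_mem {U : Set (Fin d → ℝ)} (hU : Bornology.IsBounded U) :
    {z : Fin d → ℤ | center z ∈ U}.Finite := by
  obtain ⟨R, hR⟩ := hU.subset_closedBall 0
  refine (Set.finite_Icc (fun _ => -⌈R + 1⌉ : Fin d → ℤ) (fun _ => ⌈R + 1⌉)).subset ?_
  intro z hz
  have h1 := hR hz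
  rw [mem_closedBall_zero_iff] at h1
  have h2 : ∀ i, |(z i : ℝ) + 1 / 2| ≤ R := fun i => (norm_le_pi_norm (center z) i).trans h1
  have h3 := Int.le_ceil (R + 1)
  refine ⟨fun i => ?_, fun i => ?_⟩
  · have := (abs_le.1 (h2 i)).1
    have h4 : (-⌈R + 1⌉ : ℝ) ≤ z i := by linarith
    exact_mod_cast h4
  · have := (abs_le.1 (h2 i)).2
    have h4 : (z i : ℝ) ≤ ⌈R + 1⌉ := by linarith
    exact_mod_cast h4

theorem holes_bound (hd : 1 ≤ d) {T : Finset (Fin d → ℤ)}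
    (hc : CellConnected (T : Set (Fin d → ℤ))) (F : Finset (Set (Fin d → ℝ)))
    (hF : ∀ U ∈ F, U ∈ holes (⋃ z ∈ T, tile z)) :
    2 * d * (F.card : ℝ) + 2 * d * ((T.card : ℝ) + F.card) ^ (((d : ℝ) - 1) / d) ≤
      2 * (d - 1) * (T.card : ℝ) + 2 := by
  classical
  rw [holes, compl_eq_region] at hF
  set G : Set (Fin d → ℤ) := (T : Set (Fin d → ℤ))ᶜ with hG
  have hfin : ∀ U ∈ F, {z : Fin d → ℤ | center z ∈ U}.Finite := fun U hU =>
    finite_center_mem (hF U hU).2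
  -- The cells whose centres lie in `U`. The default `∅` is never used on `F`, as holes are bounded.
  let C : Set (Fin d → ℝ) → Finset (Fin d → ℤ) := fun U =>
    if h : {z : Fin d → ℤ | center z ∈ U}.Finite then h.toFinset else ∅
  have hC : ∀ U ∈ F, ∀ z, z ∈ C U ↔ center z ∈ U := by
    intro U hU z
    simp only [C, dif_pos (hfin U hU), Set.Finite.mem_toFinset, Set.mem_ofPred_eq]
  have hCG : ∀ U ∈ F, ∀ z ∈ C U, z ∈ G := by
    intro U hU z hz
    obtain ⟨⟨x, -, rfl⟩, -⟩ := hF U hU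
    exact center_mem_region.1 (connectedComponentIn_subset _ _ ((hC _ hU z).1 hz))
  refine family_bound hd hc F C ?_ ?_ ?_ ?_
  · intro U hU
    obtain ⟨⟨x, hx, hxU⟩, -⟩ := hF U hU
    refine ⟨fun i => ⌊x i⌋, (hC U hU _).2 ?_⟩
    rw [hxU]
    exact center_mem_component (mem_connectedComponentIn hx) (mem_tile_floor x)
  · intro U hU V hV hUV
    rw [Function.onFun, Finset.disjoint_left]
    intro z hz hz'
    rw [hC _ hU] at hz
    rw [hC _ hV] at hz'
    apply hUV
    obtain ⟨⟨x, -, rfl⟩, -⟩ := hF U hU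
    obtain ⟨⟨y, -, rfl⟩, -⟩ := hF V hV
    rw [connectedComponentIn_eq hz, connectedComponentIn_eq hz']
  · intro U hU
    rw [Finset.disjoint_left]
    exact fun z hz hz' => hCG U hU z hz' hz
  · intro U hU v hv δ h
    have hvG := hCG U hU v hv
    rw [hC _ hU] at hv ⊢
    obtain ⟨⟨x, -, rfl⟩, -⟩ := hF U hU
    exact (adjClosed_center_mem_component G x v ⟨hvG, hv⟩ δ h).2

/-- The count holds for every finite family of holes, and `T.card + 2` holes already violate it.
Finiteness is needed before `ncard` is meaningful, since it is `0` on infinite sets. -/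
theorem finite_holes (hd : 1 ≤ d) {n : ℕ} {P : Set (Fin d → ℝ)} (hP : IsOmino d n P) :
    (holes P).Finite := by
  obtain ⟨T, rfl, rfl, hc⟩ := isOmino_iff.1 hP
  by_contra hinf
  obtain ⟨F, hF, hcard⟩ := Set.Infinite.exists_subset_card_eq hinf (T.card + 2)
  have hb := holes_bound hd hc F hF
  have hd1 : (1 : ℝ) ≤ d := by exact_mod_cast hd
  rw [hcard] at hb
  push_cast at hb
  have hpos : 0 ≤ 2 * d * ((T.card : ℝ) + (T.card + 2)) ^ (((d : ℝ) - 1) / d) := by positivity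
  have h0 : (0 : ℝ) ≤ T.card := by positivity
  nlinarith

theorem ncard_holes_bound (hd : 1 ≤ d) {n : ℕ} {P : Set (Fin d → ℝ)} (hP : IsOmino d n P) :
    2 * d * ((holes P).ncard : ℝ) + 2 * d * ((n : ℝ) + (holes P).ncard) ^ (((d : ℝ) - 1) / d) ≤
      2 * (d - 1) * (n : ℝ) + 2 := by
  have hfin := finite_holes hd hP
  obtain ⟨T, rfl, rfl, hc⟩ := isOmino_iff.1 hP
  rw [Set.ncard_eq_toFinset_card _ hfin]
  exact holes_bound hd hc _ fun U hU => hfin.mem_toFinset.1 hU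

theorem ncard_holes_le (hd : 1 ≤ d) {n : ℕ} {P : Set (Fin d → ℝ)} (hP : IsOmino d n P) :
    (holes P).ncard ≤ n + 1 := by
  have hb := ncard_holes_bound hd hP
  have hd1 : (1 : ℝ) ≤ d := by exact_mod_cast hd
  have hpos : 0 ≤ 2 * d * ((n : ℝ) + (holes P).ncard) ^ (((d : ℝ) - 1) / d) := by positivity
  have h0 : (0 : ℝ) ≤ n := by positivity
  have : ((holes P).ncard : ℝ) ≤ n + 1 := by nlinarith
  exact_mod_cast this

theorem bddAbove_holeCounts (hd : 1 ≤ d) (n : ℕ) : BddAbove (holeCounts d n) := by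
  refine ⟨n + 1, ?_⟩
  rintro h ⟨P, hP, rfl⟩
  exact ncard_holes_le hd hP

/-! ### The construction: a box with isolated empty cells -/

/-- An isolated empty cell is a hole. -/
theorem card_le_ncard_holes (hd : 1 ≤ d) {T S : Finset (Fin d → ℤ)}
    (hc : CellConnected (T : Set (Fin d → ℤ))) (hST : Disjoint S T)
    (hS : ∀ v ∈ S, ∀ δ, v + dir δ ∈ T) : S.card ≤ (holes (⋃ z ∈ T, tile z)).ncard := by
  have hfin := finite_holes hd (isOmino_iff.2 ⟨T, rfl, rfl, hc⟩)
  have hsub : ∀ v ∈ S, connectedComponentIn (⋃ z ∈ T, tile z)ᶜ (center v) ⊆ region {v} := by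
    intro v hv
    have hvT : v ∈ (T : Set (Fin d → ℤ))ᶜ := fun h => Finset.disjoint_left.1 hST hv h
    rw [compl_eq_region]
    -- All neighbours of `v` are in `T`, so `{v}` is adjacency-closed among the empty cells.
    refine AdjClosed.subset_region (G := (T : Set (Fin d → ℤ))ᶜ) ?_
      isPreconnected_connectedComponentIn (connectedComponentIn_subset _ _)
      (mem_connectedComponentIn (center_mem_region.2 hvT)) (center_mem_tile_iff.2 rfl) rfl
    rintro u rfl δ h
    exact absurd (hS u hv δ) h
  have hmem : ∀ v ∈ S, center v ∈ (⋃ z ∈ T, tile z)ᶜ := by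
    intro v hv
    rw [compl_eq_region]
    exact center_mem_region.2 fun h => Finset.disjoint_left.1 hST hv h
  rw [← Set.ncard_coe_finset]
  refine Set.ncard_le_ncard_of_injOn
    (fun v => connectedComponentIn (⋃ z ∈ T, tile z)ᶜ (center v)) ?_ ?_ hfin
  · intro v hv
    refine ⟨⟨_, hmem v hv, rfl⟩, ?_⟩
    refine (Metric.isBounded_Icc (fun i => (v i : ℝ)) (fun i => (v i : ℝ) + 1)).subset ?_
    intro x hx
    have h1 : (fun i => ⌊x i⌋) = v := hsub v hv hx _ (mem_tile_floor x)
    have h2 := mem_tile_floor x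
    rwa [h1] at h2
  · intro v hv w hw h
    simp only at h
    have h1 := mem_connectedComponentIn (hmem v hv)
    rw [h] at h1
    exact hsub w hw h1 v (center_mem_tile_iff.2 rfl)

/-- The cells with coordinates between `0` and `M + 1`. -/
noncomputable def box (d M : ℕ) : Finset (Fin d → ℤ) := Finset.Icc (fun _ => 0) (fun _ => (M : ℤ) + 1)

/-- The cells with coordinates between `1` and `M`. -/
noncomputable def innerBox (d M : ℕ) : Finset (Fin d → ℤ) := Finset.Icc (fun _ => 1) (fun _ => (M : ℤ))

theorem mem_box {M : ℕ} {v : Fin d → ℤ} : v ∈ box d M ↔ ∀ i, 0 ≤ v i ∧ v i ≤ M + 1 := by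
  simp only [box, Finset.mem_Icc, Pi.le_def, ← forall_and]

theorem mem_innerBox {M : ℕ} {v : Fin d → ℤ} :
    v ∈ innerBox d M ↔ ∀ i, 1 ≤ v i ∧ v i ≤ M := by
  simp only [innerBox, Finset.mem_Icc, Pi.le_def, ← forall_and]

theorem card_box (d M : ℕ) : (box d M).card = (M + 2) ^ d := by
  rw [box, Pi.card_Icc]
  simp only [Int.card_Icc, Finset.prod_const, Finset.card_univ, Fintype.card_fin]
  congr 1

theorem card_innerBox (d M : ℕ) : (innerBox d M).card = M ^ d := by
  rw [innerBox, Pi.card_Icc]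
  simp only [Int.card_Icc, Finset.prod_const, Finset.card_univ, Fintype.card_fin]
  congr 1
  omega

/-- The parity class of a cell. -/
def parity (v : Fin d → ℤ) : ZMod 2 := ((∑ i, v i : ℤ) : ZMod 2)

/-- The class of a cell in the perfect code `∑ i, i * v i ≡ b (mod 2 * d - 1)`; it does not depend
on the coordinate of index `0`. -/
def codeClass (v : Fin d → ℤ) : ZMod (2 * d - 1) := ((∑ i : Fin d, (i : ℤ) * v i : ℤ) : ZMod _)

theorem parity_add_dir (v : Fin d → ℤ) (δ : Fin d × ℤˣ) : parity (v + dir δ) = parity v + 1 := by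
  simp only [parity, Pi.add_apply, Finset.sum_add_distrib, dir, Finset.sum_pi_single',
    Finset.mem_univ, if_true, Int.cast_add]
  rcases Int.units_eq_one_or δ.2 with h | h <;> rw [h]
  · simp
  · simp only [Units.val_neg, Units.val_one]
    congr 1

theorem codeClass_add_dir (v : Fin d → ℤ) (δ : Fin d × ℤˣ) :
    codeClass (v + dir δ) = codeClass v + (((δ.1 : ℕ) : ℤ) * (δ.2 : ℤ) : ℤ) := by
  simp only [codeClass, Pi.add_apply, mul_add, Finset.sum_add_distrib, Int.cast_add]
  congr 2
  rw [Finset.sum_eq_single δ.1]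
  · simp [dir]
  · intro j _ hj
    simp [dir, Pi.single_eq_of_ne hj]
  · simp

theorem codeClass_congr {i₀ : Fin d} (h0 : (i₀ : ℕ) = 0) {v w : Fin d → ℤ}
    (h : ∀ i ≠ i₀, v i = w i) : codeClass v = codeClass w := by
  unfold codeClass
  congr 1
  refine Finset.sum_congr rfl fun i _ => ?_
  by_cases hi : i = i₀
  · subst hi; simp [h0]
  · rw [h i hi]

/-- Steps along the coordinates `1, …, d-1` change the class by `±1, …, ±(d-1)`, which are all the
nonzero residues mod `2d-1`. The representative of least absolute value of the difference gives both
coordinate and sign. -/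
theorem exists_codeClass_eq (hd : 2 ≤ d) (v : Fin d → ℤ) {b : ZMod (2 * d - 1)}
    (hb : codeClass v ≠ b) :
    ∃ δ : Fin d × ℤˣ, (δ.1 : ℕ) ≠ 0 ∧ codeClass (v + dir δ) = b := by
  have : NeZero (2 * d - 1) := ⟨by omega⟩
  set c := (b - codeClass v).valMinAbs with hc
  have hcc : ((c : ℤ) : ZMod (2 * d - 1)) = b - codeClass v := ZMod.coe_valMinAbs _
  have hne : c ≠ 0 := by
    intro h
    rw [h, Int.cast_zero] at hcc
    exact hb (sub_eq_zero.1 hcc.symm).symm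
  have hle : c.natAbs ≤ (2 * d - 1) / 2 := ZMod.natAbs_valMinAbs_le _
  have hlt : c.natAbs < d := by omega
  rcases lt_or_gt_of_ne hne with h | h
  · refine ⟨(⟨c.natAbs, hlt⟩, -1), by simpa using hne, ?_⟩
    rw [codeClass_add_dir]
    have : (((c.natAbs : ℕ) : ℤ) * ((-1 : ℤˣ) : ℤ)) = c := by
      rw [Units.val_neg, Units.val_one]; omega
    simp only [this, hcc]
    ring
  · refine ⟨(⟨c.natAbs, hlt⟩, 1), by simpa using hne, ?_⟩
    rw [codeClass_add_dir]
    have : (((c.natAbs : ℕ) : ℤ) * ((1 : ℤˣ) : ℤ)) = c := by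
      rw [Units.val_one]; omega
    simp only [this, hcc]
    ring

/-- The cells of the inner box to be left empty. -/
noncomputable def emptyCells (M : ℕ) (a : ZMod 2) (b : ZMod (2 * d - 1)) : Finset (Fin d → ℤ) :=
  (innerBox d M).filter fun v => parity v = a ∧ codeClass v ≠ b

/-- Averaging: each inner cell is counted for `2d-2` of the `2(2d-1)` pairs `(a, b)`. -/
theorem exists_card_emptyCells (hd : 2 ≤ d) (M : ℕ) :
    ∃ a b, (d - 1) * M ^ d ≤ (2 * d - 1) * (emptyCells (d := d) M a b).card := by
  have : NeZero (2 * d - 1) := ⟨by omega⟩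
  by_contra! h
  have hcount : ∑ p : ZMod 2 × ZMod (2 * d - 1), (emptyCells (d := d) M p.1 p.2).card =
      M ^ d * (2 * d - 2) := by
    simp only [emptyCells, Finset.card_filter]
    rw [Finset.sum_comm, ← card_innerBox]
    refine Finset.sum_const_nat fun v _ => ?_
    rw [← Finset.card_filter]
    have : (Finset.univ.filter fun p : ZMod 2 × ZMod (2 * d - 1) =>
        parity v = p.1 ∧ codeClass v ≠ p.2) = {parity v} ×ˢ (Finset.univ.erase (codeClass v)) := by
      ext p
      simp only [Finset.mem_filter, Finset.mem_univ, true_and, Finset.mem_product,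
        Finset.mem_singleton, Finset.mem_erase, and_true, ne_eq]
      rw [eq_comm (a := parity v), eq_comm (a := codeClass v)]
    rw [this, Finset.card_product, Finset.card_erase_of_mem (Finset.mem_univ _), Finset.card_univ,
      ZMod.card, Finset.card_singleton]
    omega
  have hlt : ∑ p : ZMod 2 × ZMod (2 * d - 1), (2 * d - 1) * (emptyCells (d := d) M p.1 p.2).card <
      ∑ p : ZMod 2 × ZMod (2 * d - 1), (d - 1) * M ^ d :=
    Finset.sum_lt_sum_of_nonempty Finset.univ_nonempty fun p _ => h p.1 p.2
  rw [← Finset.mul_sum, hcount, Finset.sum_const, Finset.card_univ, Fintype.card_prod, ZMod.card,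
    ZMod.card, smul_eq_mul] at hlt
  obtain ⟨e, rfl⟩ := Nat.exists_eq_add_of_le hd
  have h1 : 2 * (2 + e) - 2 = 2 * (e + 1) := by omega
  have h2 : 2 + e - 1 = e + 1 := by omega
  rw [h1, h2] at hlt
  refine absurd hlt (not_lt.2 (le_of_eq ?_))
  ring

theorem AdjClosed.update_mem {A G : Set (Fin d → ℤ)} (hA : AdjClosed A G) {v : Fin d → ℤ}
    (i : Fin d) (n : ℕ) (hG : ∀ t : ℕ, t ≤ n → Function.update v i (t : ℤ) ∈ G)
    (h0 : Function.update v i 0 ∈ A) : Function.update v i (n : ℤ) ∈ A := by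
  induction n with
  | zero => simpa using h0
  | succ n ih =>
    have hstep : Function.update v i ((n + 1 : ℕ) : ℤ) =
        Function.update v i (n : ℤ) + dir (i, 1) := by
      funext j
      by_cases hj : j = i
      · subst hj; simp [dir]
      · simp [dir, Function.update_of_ne hj, Pi.single_eq_of_ne hj]
    have hmem := hG (n + 1) le_rfl
    rw [hstep] at hmem ⊢
    exact hA _ (ih fun t ht => hG t (by omega)) _ hmem

/-- Leaving out empty cells does not disconnect the box. -/
theorem cellConnected_box_sdiff (hd : 2 ≤ d) {M : ℕ} {a : ZMod 2} {b : ZMod (2 * d - 1)}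
    {S : Finset (Fin d → ℤ)} (hS : S ⊆ emptyCells M a b) :
    CellConnected ((box d M \ S : Finset (Fin d → ℤ)) : Set (Fin d → ℤ)) := by
  classical
  set G : Set (Fin d → ℤ) := ((box d M \ S : Finset (Fin d → ℤ)) : Set (Fin d → ℤ)) with hG
  have hmemG : ∀ v : Fin d → ℤ, v ∈ box d M → (v ∈ innerBox d M → codeClass v = b) → v ∈ G := by
    intro v hv h
    refine Finset.mem_coe.2 (Finset.mem_sdiff.2 ⟨hv, fun hvS => ?_⟩)
    have := Finset.mem_filter.1 (hS hvS)
    exact this.2.2 (h this.1)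
  let i₀ : Fin d := ⟨0, by omega⟩
  -- The face where coordinate `0` vanishes misses the inner box, so it is full.
  have hbottom : ∀ v ∈ box d M, v i₀ = 0 → v ∈ G := by
    intro v hv h0
    refine hmemG v hv fun hin => ?_
    have := (mem_innerBox.1 hin i₀).1
    omega
  have hzero : (0 : Fin d → ℤ) ∈ box d M := mem_box.2 fun i => ⟨le_rfl, by simp; omega⟩
  refine ⟨0, hbottom 0 hzero rfl, fun A _ h0A hA => ?_⟩
  have hface : ∀ v ∈ box d M, v i₀ = 0 → v ∈ A := by
    intro v hv hv0
    have key : ∀ s : Finset (Fin d), s.piecewise v 0 ∈ A := by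
      intro s
      induction s using Finset.induction_on with
      | empty => simpa using h0A
      | insert i s his ih =>
        rw [Finset.piecewise_insert]
        obtain ⟨n, hn⟩ := Int.eq_ofNat_of_zero_le (mem_box.1 hv i).1
        rw [hn]
        refine hA.update_mem i n (fun t ht => ?_) ?_
        · have hvi := (mem_box.1 hv i).2
          refine hbottom _ (mem_box.2 fun j => ?_) ?_
          · by_cases hj : j = i
            · subst hj; simp; omega
            · rw [Function.update_of_ne hj]
              by_cases hjs : j ∈ s
              · rw [Finset.piecewise_eq_of_mem _ _ _ hjs]; exact mem_box.1 hv j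
              · rw [Finset.piecewise_eq_of_notMem _ _ _ hjs]; exact mem_box.1 hzero j
          · by_cases hj : i₀ = i
            · subst hj; simp; omega
            · rw [Function.update_of_ne hj]
              by_cases hjs : i₀ ∈ s
              · rw [Finset.piecewise_eq_of_mem _ _ _ hjs, hv0]
              · rw [Finset.piecewise_eq_of_notMem _ _ _ hjs]; rfl
        · rwa [Function.update_eq_self_iff.2]
          rw [Finset.piecewise_eq_of_notMem _ _ _ his]; rfl
    simpa using key Finset.univ
  -- The lines in direction `0` through code cells, or outside the inner box in another coordinate,
  -- are full down to that face.
  have hline : ∀ v ∈ box d M, (codeClass v = b ∨ ∃ i ≠ i₀, ¬ (1 ≤ v i ∧ v i ≤ M)) → v ∈ A := by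
    intro v hv hgood
    obtain ⟨n, hn⟩ := Int.eq_ofNat_of_zero_le (mem_box.1 hv i₀).1
    have hvn := (mem_box.1 hv i₀).2
    have hbox : ∀ t : ℕ, t ≤ n → Function.update v i₀ (t : ℤ) ∈ box d M := by
      intro t ht
      refine mem_box.2 fun j => ?_
      by_cases hj : j = i₀
      · rw [hj, Function.update_self]; omega
      · rw [Function.update_of_ne hj]; exact mem_box.1 hv j
    have := hA.update_mem (v := v) i₀ n (fun t ht => hmemG _ (hbox t ht) fun hin => ?_)
      (hface _ (by simpa using hbox 0 (Nat.zero_le _)) (Function.update_self _ _ _))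
    · rw [← hn] at this
      simpa using this
    · rcases hgood with h | ⟨i, hi, h⟩
      · rw [← h]
        exact codeClass_congr (i₀ := i₀) rfl fun j hj => Function.update_of_ne hj _ _
      · have := mem_innerBox.1 hin i
        rw [Function.update_of_ne hi] at this
        exact absurd this h
  intro v hvG
  have hv : v ∈ box d M := (Finset.mem_sdiff.1 (Finset.mem_coe.1 hvG)).1
  by_cases hgood : codeClass v = b ∨ ∃ i ≠ i₀, ¬ (1 ≤ v i ∧ v i ≤ M)
  · exact hline v hv hgood
  · push Not at hgood
    obtain ⟨hcode, hin⟩ := hgood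
    -- Any remaining cell is one step from a code line. The step stays in the box because coordinate
    -- `i` lies between `1` and `M`.
    obtain ⟨⟨i, u⟩, hi, hcl⟩ := exists_codeClass_eq hd v hcode
    have hii : i ≠ i₀ := fun h => hi (by rw [h])
    have hw : v + dir (i, u) ∈ A := by
      refine hline _ (mem_box.2 fun j => ?_) (Or.inl hcl)
      by_cases hj : j = i
      · subst hj
        have := hin j hii
        simp only [Pi.add_apply, dir, Pi.single_eq_same]
        rcases Int.units_eq_one_or u with rfl | rfl
        · rw [Units.val_one]; omega
        · rw [Units.val_neg, Units.val_one]; omega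
      · simpa [dir, Pi.single_eq_of_ne hj] using mem_box.1 hv j
    have hback : v + dir (i, u) + dir (i, -u) = v := by rw [dir_neg, add_neg_cancel_right]
    have := hA _ hw (i, -u)
    rw [hback] at this
    exact this hvG

/-- Any subset of the admissible empty cells works, so emptying exactly `(M + 2) ^ d - n` of them
leaves `n` tiles. -/
theorem exists_isOmino (hd : 2 ≤ d) {M n : ℕ} (hn : n ≤ (M + 2) ^ d)
    (hM : (2 * d - 1) * ((M + 2) ^ d - n) ≤ (d - 1) * M ^ d) :
    ∃ P : Set (Fin d → ℝ), IsOmino d n P ∧ (M + 2) ^ d - n ≤ (holes P).ncard := by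
  classical
  obtain ⟨a, b, hab⟩ := exists_card_emptyCells hd M
  have hle : (M + 2) ^ d - n ≤ (emptyCells (d := d) M a b).card :=
    Nat.le_of_mul_le_mul_left (hM.trans hab) (by omega)
  obtain ⟨S, hS, hcard⟩ := Finset.exists_subset_card_eq hle
  have hinner : ∀ v ∈ S, v ∈ innerBox d M := fun v hv => (Finset.mem_filter.1 (hS hv)).1
  have hbox : S ⊆ box d M := fun v hv => mem_box.2 fun i => by
    have := mem_innerBox.1 (hinner v hv) i
    omega
  have hc := cellConnected_box_sdiff hd hS
  refine ⟨⋃ z ∈ box d M \ S, tile z, isOmino_iff.2 ⟨_, ?_, rfl, hc⟩, ?_⟩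
  · rw [Finset.card_sdiff_of_subset hbox, card_box, hcard]
    omega
  · rw [← hcard]
    refine card_le_ncard_holes (by omega) hc Finset.disjoint_sdiff fun v hv δ => ?_
    refine Finset.mem_sdiff.2 ⟨mem_box.2 fun j => ?_, fun h => ?_⟩
    · have := mem_innerBox.1 (hinner v hv) j
      by_cases hj : j = δ.1
      · subst hj
        simp only [Pi.add_apply, dir, Pi.single_eq_same]
        rcases Int.units_eq_one_or δ.2 with h | h
        · rw [h, Units.val_one]; omega
        · rw [h, Units.val_neg, Units.val_one]; omega
      · simp only [Pi.add_apply, dir, Pi.single_eq_of_ne hj]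
        omega
    -- Neighbours have opposite parity, so no two empty cells are adjacent.
    · have h1 := (Finset.mem_filter.1 (hS hv)).2.1
      have h2 := (Finset.mem_filter.1 (hS h)).2.1
      rw [parity_add_dir, h1] at h2
      exact absurd (left_eq_add.1 h2.symm) (by decide)

/-! ### The maximum is attained, and its two bounds -/

theorem holeCounts_nonempty (hd : 1 ≤ d) {n : ℕ} (hn : 1 ≤ n) : (holeCounts d n).Nonempty := by
  classical
  let i₀ : Fin d := ⟨0, hd⟩
  let f : ℕ → Fin d → ℤ := fun t => Function.update 0 i₀ (t : ℤ)
  have hinj : Function.Injective f := by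
    intro s t h
    simpa [f] using congrFun h i₀
  refine ⟨_, _, isOmino_iff.2 ⟨(Finset.range n).image f, ?_, rfl, ?_⟩, rfl⟩
  · rw [Finset.card_image_of_injective _ hinj, Finset.card_range]
  · refine ⟨f 0, ?_, fun A _ h0 hA => ?_⟩
    · exact Finset.mem_coe.2 (Finset.mem_image_of_mem _ (Finset.mem_range.2 hn))
    · intro v hv
      obtain ⟨t, ht, rfl⟩ := Finset.mem_image.1 (Finset.mem_coe.1 hv)
      refine hA.update_mem i₀ t (fun s hs => ?_) (by simpa [f] using h0)
      exact Finset.mem_coe.2 (Finset.mem_image_of_mem f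
        (Finset.mem_range.2 (hs.trans_lt (Finset.mem_range.1 ht))))

theorem isGreatest_maxHoles (hd : 1 ≤ d) {n : ℕ} (hn : 1 ≤ n) :
    IsGreatest (holeCounts d n) (maxHoles d n) :=
  ⟨Nat.sSup_mem (holeCounts_nonempty hd hn) (bddAbove_holeCounts hd n),
    fun _ h => le_csSup (bddAbove_holeCounts hd n) h⟩

theorem le_maxHoles (hd : 2 ≤ d) {M n : ℕ} (hn : n ≤ (M + 2) ^ d)
    (hM : (2 * d - 1) * ((M + 2) ^ d - n) ≤ (d - 1) * M ^ d) :
    (M + 2) ^ d - n ≤ maxHoles d n := by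
  obtain ⟨P, hP, hle⟩ := exists_isOmino hd hn hM
  exact hle.trans (le_csSup (bddAbove_holeCounts (by omega) n) ⟨P, hP, rfl⟩)

theorem maxHoles_bound (hd : 1 ≤ d) {n : ℕ} (hn : 1 ≤ n) :
    2 * d * (maxHoles d n : ℝ) + 2 * d * ((n : ℝ) + maxHoles d n) ^ (((d : ℝ) - 1) / d) ≤
      2 * (d - 1) * (n : ℝ) + 2 := by
  obtain ⟨P, hP, h⟩ := (isGreatest_maxHoles hd hn).1
  rw [← h]
  exact ncard_holes_bound hd hP

end

/-! ### Asymptotics -/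

theorem pow_succ_sub_le_sub_one_pow {x : ℝ} (hx : 1 ≤ x) (k : ℕ) :
    x ^ (k + 1) - (k + 1) * x ^ k ≤ (x - 1) ^ (k + 1) := by
  induction k with
  | zero => simp
  | succ k ih =>
    have h1 := mul_le_mul_of_nonneg_right ih (by linarith : 0 ≤ x - 1)
    have h2 : 0 ≤ ((k : ℝ) + 1) * x ^ k := by positivity
    rw [pow_succ (x - 1)]
    refine le_trans ?_ h1
    push_cast
    rw [pow_succ x (k + 1), pow_succ x k]
    nlinarith

theorem add_one_pow_le {x : ℝ} (hx : 1 ≤ x) (k : ℕ) :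
    (x + 1) ^ (k + 1) ≤ x ^ (k + 1) + (k + 1) * 2 ^ k * x ^ k := by
  have h1 := pow_succ_sub_le_sub_one_pow (by linarith : 1 ≤ x + 1) k
  have h2 : (x + 1) ^ k ≤ (2 * x) ^ k := pow_le_pow_left₀ (by linarith) (by linarith) k
  rw [mul_pow] at h2
  have h3 := mul_le_mul_of_nonneg_left h2 (by positivity : (0 : ℝ) ≤ k + 1)
  rw [add_sub_cancel_right] at h1
  linarith

theorem eventually_mul_rpow_le {d : ℕ} (hd : 1 ≤ d) (A : ℝ) :
    ∀ᶠ n : ℕ in atTop, A * (n : ℝ) ^ (((d : ℝ) - 1) / d) ≤ n := by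
  have hd0 : (0 : ℝ) < d := by exact_mod_cast hd
  have ht := (tendsto_rpow_atTop (by positivity : 0 < 1 / (d : ℝ))).comp
    (tendsto_natCast_atTop_atTop (R := ℝ))
  filter_upwards [ht.eventually_ge_atTop A, eventually_ge_atTop 1] with n hn h1
  have hn0 : (0 : ℝ) < n := by exact_mod_cast h1
  calc A * (n : ℝ) ^ (((d : ℝ) - 1) / d)
      ≤ (n : ℝ) ^ (1 / (d : ℝ)) * (n : ℝ) ^ (((d : ℝ) - 1) / d) :=
        mul_le_mul_of_nonneg_right hn (by positivity)
    _ = n := by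
      rw [← Real.rpow_add hn0, ← add_div, add_sub_cancel, div_self hd0.ne', Real.rpow_one]

theorem eventually_maxHoles_le {d : ℕ} (hd : 2 ≤ d) :
    ∀ᶠ n : ℕ in atTop, (maxHoles d n : ℝ) ≤
      ((d : ℝ) - 1) / d * n - (n : ℝ) ^ (((d : ℝ) - 1) / d) := by
  have hD : (2 : ℝ) ≤ d := by exact_mod_cast hd
  set D : ℝ := (d : ℝ) with hDdef
  set α : ℝ := (D - 1) / D with hα
  have hα0 : 0 < α := div_pos (by linarith) (by linarith)
  have hα1 : 1 / 2 ≤ α := by rw [hα, div_le_div_iff₀ (by norm_num) (by linarith)]; linarith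
  have hc : 0 < (5 / 4 : ℝ) ^ α - 1 := sub_pos.2 (Real.one_lt_rpow (by norm_num) hα0)
  have ht := (tendsto_rpow_atTop hα0).comp (tendsto_natCast_atTop_atTop (R := ℝ))
  filter_upwards [eventually_mul_rpow_le (d := d) (by omega) 4, eventually_ge_atTop 1,
    ht.eventually_ge_atTop (1 / ((5 / 4 : ℝ) ^ α - 1))] with n hn h1 hbig
  simp only [Function.comp_apply] at hbig
  rw [← hDdef, ← hα] at hn
  have hb := maxHoles_bound (d := d) (by omega) h1
  rw [← hDdef, ← hα] at hb
  set f : ℝ := (maxHoles d n : ℝ) with hf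
  have hf0 : 0 ≤ f := Nat.cast_nonneg _
  have hn0 : (0 : ℝ) ≤ n := Nat.cast_nonneg _
  -- If `f ≤ n / 4` the bound is trivial for large `n`. Otherwise `(n + f) ^ α ≥ (5 / 4) ^ α * n ^
  -- α`, and the excess over `n ^ α` absorbs the constant 2 in `hb`.
  rcases le_or_gt f (n / 4) with h | h
  · have := mul_le_mul_of_nonneg_right hα1 hn0
    linarith
  · have h2 : (5 / 4 : ℝ) ^ α * (n : ℝ) ^ α ≤ (n + f) ^ α := by
      rw [← Real.mul_rpow (by norm_num) hn0]
      exact Real.rpow_le_rpow (by positivity) (by linarith) hα0.le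
    rw [div_le_iff₀ hc] at hbig
    have h3 : (n : ℝ) ^ α + 1 ≤ (n + f) ^ α := by nlinarith
    have h4 : D * f ≤ (D - 1) * n - D * (n : ℝ) ^ α := by
      have := mul_le_mul_of_nonneg_left h3 (by linarith : 0 ≤ D)
      linarith
    have h5 : D * (α * n - (n : ℝ) ^ α) = (D - 1) * n - D * (n : ℝ) ^ α := by
      rw [hα]; field_simp
    exact le_of_mul_le_mul_left (h4.trans_eq h5.symm) (by linarith)

/-- The first inequality is the condition under which `le_maxHoles` applies. It holds at `M = 0` and
fails for large `M`, so it holds at some `M` and fails at `M + 1`. -/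
theorem exists_box_size {d : ℕ} (hd : 1 ≤ d) {n : ℕ} (hn : 2 ^ d ≤ n) :
    ∃ M : ℕ, (2 * d - 1) * (M + 2) ^ d ≤ (2 * d - 1) * n + (d - 1) * M ^ d ∧
      (2 * d - 1) * n + (d - 1) * (M + 1) ^ d < (2 * d - 1) * (M + 3) ^ d := by
  by_contra! h
  have hall : ∀ M : ℕ, (2 * d - 1) * (M + 2) ^ d ≤ (2 * d - 1) * n + (d - 1) * M ^ d := by
    intro M
    induction M with
    | zero => exact (Nat.mul_le_mul_left _ (by simpa using hn)).trans (Nat.le_add_right _ _)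
    | succ M ih => exact h M ih
  -- The inequality implies `d * (M + 2) ^ d ≤ (2 * d - 1) * n`, which is false for this `M`.
  obtain ⟨M, hM⟩ : ∃ M, M = (2 * d - 1) * n := ⟨_, rfl⟩
  have h1 := hall M
  have h2 : M ^ d ≤ (M + 2) ^ d := Nat.pow_le_pow_left (by omega) d
  have h3 : M + 2 ≤ (M + 2) ^ d := Nat.le_self_pow (by omega) _
  obtain ⟨e, rfl⟩ := Nat.exists_eq_add_of_le hd
  rw [← hM, show 2 * (1 + e) - 1 = e + (e + 1) by omega, show 1 + e - 1 = e by omega, add_mul] at h1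
  have h4 := Nat.mul_le_mul_left e h2
  have h5 : (M + 2) ^ (1 + e) ≤ (e + 1) * (M + 2) ^ (1 + e) :=
    Nat.le_mul_of_pos_left _ (Nat.succ_pos e)
  omega

theorem eventually_le_maxHoles {d : ℕ} (hd : 2 ≤ d) :
    ∃ C : ℝ, 0 < C ∧ ∀ᶠ n : ℕ in atTop,
      ((d : ℝ) - 1) / d * n - C * (n : ℝ) ^ (((d : ℝ) - 1) / d) ≤ (maxHoles d n : ℝ) := by
  have hD : (2 : ℝ) ≤ d := by exact_mod_cast hd
  obtain ⟨k, rfl⟩ := Nat.exists_eq_add_of_le' (by omega : 1 ≤ d)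
  set D : ℝ := ((k + 1 : ℕ) : ℝ) with hDdef
  have hDk : (k : ℝ) + 1 = D := by rw [hDdef]; push_cast; ring
  set α : ℝ := (D - 1) / D with hα
  have hα0 : 0 < α := div_pos (by linarith) (by linarith)
  have hα1 : α ≤ 1 := by rw [hα, div_le_one (by linarith)]; linarith
  -- `K * x ^ k` bounds the error when `(x + 1) ^ (k + 1)` and `(x - 1) ^ (k + 1)` in `h2` are
  -- replaced by `x ^ (k + 1)`.
  set K : ℝ := (2 * D - 1) * (D * 2 ^ k) + (D - 1) * D with hK
  have hK0 : 0 < K := by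
    have h1 : 0 < (2 * D - 1) * (D * 2 ^ k) :=
      mul_pos (by linarith) (mul_pos (by linarith) (by positivity))
    have h2 : 0 ≤ (D - 1) * D := mul_nonneg (by linarith) (by linarith)
    linarith
  refine ⟨2 * K / D, div_pos (by linarith) (by linarith), ?_⟩
  filter_upwards [eventually_mul_rpow_le (d := k + 1) (by omega) (2 * K),
    eventually_ge_atTop (2 ^ (k + 1))] with n hbig hn
  rw [← hDdef, ← hα] at hbig
  obtain ⟨M, hM1, hM2⟩ := exists_box_size (by omega) hn
  set x : ℝ := (M : ℝ) + 2 with hx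
  have hM0 : (0 : ℝ) ≤ M := Nat.cast_nonneg _
  have hn0 : (0 : ℝ) ≤ n := Nat.cast_nonneg _
  have hc1 : ((2 * (k + 1) - 1 : ℕ) : ℝ) = 2 * D - 1 := by
    rw [Nat.cast_sub (by omega)]; push_cast; rw [hDk]
  have hc2 : ((k + 1 - 1 : ℕ) : ℝ) = D - 1 := by
    rw [Nat.cast_sub (by omega), Nat.cast_one]
  have h1 : (2 * D - 1) * x ^ (k + 1) ≤ (2 * D - 1) * n + (D - 1) * (M : ℝ) ^ (k + 1) := by
    rw [← hc1, ← hc2, hx]; exact_mod_cast hM1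
  have h2 : (2 * D - 1) * n + (D - 1) * (x - 1) ^ (k + 1) ≤ (2 * D - 1) * (x + 1) ^ (k + 1) := by
    have e1 : x - 1 = ((M + 1 : ℕ) : ℝ) := by rw [hx]; push_cast; ring
    have e2 : x + 1 = ((M + 3 : ℕ) : ℝ) := by rw [hx]; push_cast; ring
    rw [← hc1, ← hc2, e1, e2]; exact_mod_cast hM2.le
  have hx1 : 1 ≤ x := by linarith
  have h3 : x ^ (k + 1) ≤ 2 * n := by
    have h4 : (M : ℝ) ^ (k + 1) ≤ x ^ (k + 1) := pow_le_pow_left₀ hM0 (by linarith) _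
    have h5 := mul_le_mul_of_nonneg_left h4 (by linarith : 0 ≤ D - 1)
    have h6 : D * x ^ (k + 1) ≤ D * (2 * n) := by linarith
    exact le_of_mul_le_mul_left h6 (by linarith)
  have h4 : x ^ k ≤ 2 * (n : ℝ) ^ α := by
    calc x ^ k = (x ^ (k + 1)) ^ α := by
          rw [← Real.rpow_natCast x (k + 1), ← Real.rpow_mul (by linarith), ← hDdef, hα,
            mul_div_cancel₀ _ (by linarith : D ≠ 0), ← hDk, add_sub_cancel_right,
            Real.rpow_natCast]
      _ ≤ (2 * n) ^ α := Real.rpow_le_rpow (by positivity) h3 hα0.le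
      _ = 2 ^ α * (n : ℝ) ^ α := Real.mul_rpow (by norm_num) hn0
      _ ≤ 2 * (n : ℝ) ^ α := by
          refine mul_le_mul_of_nonneg_right ?_ (by positivity)
          simpa using Real.rpow_le_rpow_of_exponent_le (by norm_num : (1 : ℝ) ≤ 2) hα1
  have h5 : (2 * D - 1) * n ≤ D * x ^ (k + 1) + K * x ^ k := by
    have h6 := mul_le_mul_of_nonneg_left (pow_succ_sub_le_sub_one_pow hx1 k)
      (by linarith : 0 ≤ D - 1)
    have h7 := mul_le_mul_of_nonneg_left (add_one_pow_le hx1 k) (by linarith : 0 ≤ 2 * D - 1)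
    rw [hDk] at h6 h7
    rw [hK]
    linarith
  have h6 : (2 * D - 1) * n - 2 * K * (n : ℝ) ^ α ≤ D * x ^ (k + 1) := by
    have := mul_le_mul_of_nonneg_left h4 hK0.le
    linarith
  -- This needs `2 * K * n ^ α ≤ (D - 1) * n`, which follows from `hbig` and `D ≥ 2`.
  have h7 : (n : ℝ) ≤ x ^ (k + 1) := by
    have h8 : D * n ≤ D * x ^ (k + 1) := by nlinarith
    exact le_of_mul_le_mul_left h8 (by linarith)
  have hnM : n ≤ (M + 2) ^ (k + 1) := by
    rw [hx] at h7
    exact_mod_cast h7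
  have hle := le_maxHoles hd hnM (by rw [Nat.mul_sub]; omega)
  have hle' : x ^ (k + 1) - n ≤ (maxHoles (k + 1) n : ℝ) := by
    have : (((M + 2) ^ (k + 1) - n : ℕ) : ℝ) ≤ (maxHoles (k + 1) n : ℝ) := by exact_mod_cast hle
    rw [Nat.cast_sub hnM] at this
    push_cast at this
    exact this
  refine le_trans ?_ hle'
  have h8 : D * (α * n - 2 * K / D * (n : ℝ) ^ α) ≤ D * (x ^ (k + 1) - n) := by
    have : D * (α * n - 2 * K / D * (n : ℝ) ^ α) = (D - 1) * n - 2 * K * (n : ℝ) ^ α := by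
      rw [hα]; field_simp
    rw [this]
    linarith
  exact le_of_mul_le_mul_left h8 (by linarith)

end Polyomino

theorem theorem1 (d : ℕ) (hd : 2 ≤ d) :
    -- the maximum defining `f_d(n)` is over finite numbers, and is attained
    (∀ n : ℕ, 1 ≤ n →
      (∀ P : Set (Fin d → ℝ), Polyomino.IsOmino d n P → (Polyomino.holes P).Finite) ∧
      IsGreatest (Polyomino.holeCounts d n) (Polyomino.maxHoles d n)) ∧
    -- `f_d(n) = (d - 1) / d * n - Θ(n ^ ((d - 1) / d))`
    (∃ c C : ℝ, 0 < c ∧ 0 < C ∧ ∀ᶠ n : ℕ in atTop,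
      ((d : ℝ) - 1) / d * n - C * (n : ℝ) ^ (((d : ℝ) - 1) / d) ≤ (Polyomino.maxHoles d n : ℝ) ∧
      (Polyomino.maxHoles d n : ℝ) ≤
        ((d : ℝ) - 1) / d * n - c * (n : ℝ) ^ (((d : ℝ) - 1) / d)) ∧
    -- the explicit upper bound
    (∀ᶠ n : ℕ in atTop,
      (Polyomino.maxHoles d n : ℝ) ≤
        ((d : ℝ) - 1) / d * n - (n : ℝ) ^ (((d : ℝ) - 1) / d)) := by
  have hd1 : 1 ≤ d := by omega
  refine ⟨fun n hn => ⟨fun P hP => Polyomino.finite_holes hd1 hP,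
    Polyomino.isGreatest_maxHoles hd1 hn⟩, ?_, Polyomino.eventually_maxHoles_le hd⟩
  obtain ⟨C, hC, hlow⟩ := Polyomino.eventually_le_maxHoles hd
  refine ⟨1, C, one_pos, hC, ?_⟩
  filter_upwards [hlow, Polyomino.eventually_maxHoles_le hd] with n h1 h2
  exact ⟨h1, by rwa [one_mul]⟩
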